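/- Let $p_X,p_Y\in[0,1]$ and let $\delta\ge 0$ be a fixed integer. On a probability space let $(X_i)_{i\ge1}$ be i.i.d. Bernoulli$(p_X)$ random variables and $(Y_j)_{j\ge1}$ be i.i.d. Bernoulli$(p_Y)$ random variables, the two sequences being independent of each other. For $T\in\mathbb N$ put $$S_{T,\delta}=\{(i,j)\in\{1,\dots,T\}^2 : |i-j|\le\delta,\ X_i=Y_j=1\}$$ and let $|S_{T,\delta}|$ denote its cardinality. Then, as $T\to\infty$, $$\frac{|S_{T,\delta}|-\mathbb E\,|S_{T,\delta}|}{\sqrt T}\ \longrightarrow\ \mathcal N(0,\sigma_\delta^2)\quad\text{in distribution},$$ where $$\sigma_\delta^2=(2\delta+1)\,p_Xp_Y\,(1-p_Xp_Y)+2\delta(2\delta+1)\,p_Xp_Y\bigl(p_Y(1-p_X)+p_X(1-p_Y)\bigr),$$ and $\mathcal N(0,0)$ is understood as the point mass at $0$. -/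

import Mathlib

open MeasureTheory ProbabilityTheory Filter
open scoped NNReal unitInterval

/-- The set of marks in the `δ`-band for two sequences `x₁, x₂, …` and `y₁, y₂, …` up to the
time horizon `T`: all `(i, j) ∈ {1, …, T}²` with `|i - j| ≤ δ` and `x i = y j = 1`. -/
noncomputable def bandMarks (x y : ℕ → ℝ) (T δ : ℕ) : Finset (ℕ × ℕ) :=
  open Classical in
  {q ∈ Finset.Icc 1 T ×ˢ Finset.Icc 1 T | |(q.1 : ℤ) - (q.2 : ℤ)| ≤ (δ : ℤ) ∧ x q.1 = 1 ∧ y q.2 = 1}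

/-- The random number `|S_{T,δ}|` of marks in the `δ`-band, as a real random variable. -/
noncomputable def numMarks {Ω : Type*} (X Y : ℕ → Ω → ℝ) (δ T : ℕ) (ω : Ω) : ℝ :=
  ((bandMarks (fun i => X i ω) (fun j => Y j ω) T δ).card : ℝ)

/-- The constant `σ_δ²`. -/
noncomputable def sigmaSq (pX pY : ℝ) (δ : ℕ) : ℝ :=
  (2 * δ + 1) * pX * pY * (1 - pX * pY)
    + 2 * δ * (2 * δ + 1) * pX * pY * (pY * (1 - pX) + pX * (1 - pY))

theorem sigmaSq_nonneg (pX pY : I) (δ : ℕ) : 0 ≤ sigmaSq pX pY δ := by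
  have hX := pX.2.1
  have hY := pY.2.1
  have hX' : (0 : ℝ) ≤ 1 - pX := sub_nonneg.2 pX.2.2
  have hY' : (0 : ℝ) ≤ 1 - pY := sub_nonneg.2 pY.2.2
  have hXY : (0 : ℝ) ≤ 1 - pX * pY := sub_nonneg.2 (mul_le_one₀ pX.2.2 hY pY.2.2)
  unfold sigmaSq
  positivity

/-! Grouping the marks by row turns `|S_{T,δ}|` into a sum over `n < T` of one fixed function of the
window `n, …, n + 2δ` of the iid pairs `(X, Y)`, up to a boundary error bounded independently of `T`
(`abs_card_bandMarks_sub_le`). The centred row sums `ξ n` are bounded, stationary and independent at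
distance at least `m = 2δ + 1`, so a central limit theorem for such sequences suffices
(`tendstoInDistribution_sum_window`).

That theorem uses Bernstein blocks. Gaps of length `m` make the block sums iid, so the classical
theorem applies to them. The discarded terms have small second moment (`integral_sq_sum_le`), hence
little effect on characteristic functions (`norm_charFun_map_sub_le`). Letting the block length grow
gives the limit. Nothing is divided by the variance, so `σ_δ² = 0` needs no separate case.

The limit variance is `γ(0) + 2 ∑_{d ≥ 1} γ(d)`, where `γ(d)` is the covariance of `ξ n` and `ξ (n +
d)`. For `d ≥ 1` two rows share no `X` and exactly `(m - d)⁺` of the `Y`, so `γ(d) = p_X² p_Y (1 -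
p_Y) (m - d)⁺` (`integral_rowSum_mul_rowSum`). -/

/-! ### Independence and stationarity of windows -/

theorem iIndepFun_sigma_curry {Ω ι : Type*} {κ : ι → Type*} {mΩ : MeasurableSpace Ω}
    {P : Measure Ω} {𝓧 : (i : ι) → κ i → Type*} {m𝓧 : ∀ i j, MeasurableSpace (𝓧 i j)}
    {X : (i : ι) → (j : κ i) → Ω → 𝓧 i j} (mX : ∀ i j, Measurable (X i j))
    (h : iIndepFun (fun (p : (i : ι) × κ i) ω => X p.1 p.2 ω) P) :
    iIndepFun (fun i ω j => X i j ω) P := by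
  have := h.isProbabilityMeasure
  have : ∀ i j, IsProbabilityMeasure (P.map (X i j)) :=
    fun i j => Measure.isProbabilityMeasure_map (mX i j).aemeasurable
  have h2 : ∀ i, iIndepFun (X i) P := fun i =>
    h.precomp (g := fun j => (⟨i, j⟩ : (i : ι) × κ i)) (fun a b hab => by simpa using hab)
  have hc : (MeasurableEquiv.piCurry 𝓧) ∘ (fun ω p => X p.1 p.2 ω) = fun ω i j => X i j ω := by
    ext; simp [Sigma.curry]
  rw [iIndepFun_iff_map_fun_eq_infinitePi_map (by fun_prop), ← hc,
    ← Measure.map_map (by fun_prop) (by fun_prop),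
    (iIndepFun_iff_map_fun_eq_infinitePi_map (by fun_prop)).1 h,
    Measure.infinitePi_map_piCurry (fun i j => P.map (X i j))]
  congrm Measure.infinitePi fun i => ?_
  rw [(iIndepFun_iff_map_fun_eq_infinitePi_map (by fun_prop)).1 (h2 i)]

/-- Functionals of disjoint windows of length `N` of an independent sequence are independent. -/
theorem iIndepFun_windows {Ω E ι : Type*} {mΩ : MeasurableSpace Ω} {P : Measure Ω}
    {mE : MeasurableSpace E} {W : ℕ → Ω → E} (hW : iIndepFun W P) (mW : ∀ n, Measurable (W n))
    {f : (ℕ → E) → ℝ} (hf : Measurable f) {N : ℕ} (hloc : DependsOn f (Set.Iio N))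
    {s : ι → ℕ} (hs : ∀ b b', b ≠ b' → s b + N ≤ s b' ∨ s b' + N ≤ s b) :
    iIndepFun (fun b ω => f (fun k => W (s b + k) ω)) P := by
  have := hW.isProbabilityMeasure
  obtain ⟨ω₀⟩ : Nonempty Ω := P.nonempty_of_neZero
  have hinj : Function.Injective (fun p : (_ : ι) × Fin N => s p.1 + (p.2 : ℕ)) := by
    rintro ⟨b, k⟩ ⟨b', k'⟩ h
    simp only at h
    have hb : b = b' := by
      by_contra hne
      have := hs b b' hne
      omega
    subst hb
    have : k = k' := Fin.ext (by omega)
    rw [this]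
  have h1 := iIndepFun_sigma_curry (X := fun (b : ι) (k : Fin N) => W (s b + k))
    (fun _ _ => mW _) (hW.precomp hinj)
  -- `W 0 ω₀` only pads the finite window to a full sequence; by `hloc` its value does not affect
  -- `f`.
  have h2 := h1.comp (fun _ (z : Fin N → E) => f (fun k => if h : k < N then z ⟨k, h⟩ else W 0 ω₀))
    (fun _ => hf.comp (measurable_pi_lambda _ fun k => by
      by_cases h : k < N
      · simp only [h, dif_pos]; fun_prop
      · simp only [h, dif_neg, not_false_eq_true]; fun_prop))
  convert h2 using 2 with b
  ext ω
  refine hloc fun k hk => ?_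
  simp [Set.mem_Iio.1 hk]

theorem identDistrib_shift {Ω E : Type*} {mΩ : MeasurableSpace Ω} {P : Measure Ω}
    {mE : MeasurableSpace E} {W : ℕ → Ω → E} (hW : iIndepFun W P)
    (hid : ∀ n, IdentDistrib (W n) (W 0) P P) (i j : ℕ) :
    IdentDistrib (fun ω k => W (i + k) ω) (fun ω k => W (j + k) ω) P P :=
  IdentDistrib.pi (fun k => (hid (i + k)).trans (hid (j + k)).symm)
    (hW.precomp (add_right_injective i)) (hW.precomp (add_right_injective j))

/-! ### Second moments and characteristic functions -/

/-- In the expanded square each index correlates with at most `2m` others, so the bound is linear in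
`A.card`, whatever the shape of `A`. -/
theorem integral_sq_sum_le {Ω : Type*} {mΩ : MeasurableSpace Ω} {P : Measure Ω}
    [IsProbabilityMeasure P] {ξ : ℕ → Ω → ℝ} (mξ : ∀ n, Measurable (ξ n)) {C : ℝ}
    (hb : ∀ n ω, |ξ n ω| ≤ C) {m : ℕ} (h0 : ∀ i j, i + m ≤ j → ∫ ω, ξ i ω * ξ j ω ∂P = 0)
    (A : Finset ℕ) :
    ∫ ω, (∑ i ∈ A, ξ i ω) ^ 2 ∂P ≤ A.card * (2 * m * C ^ 2) := by
  have hprod : ∀ i j ω, |ξ i ω * ξ j ω| ≤ C ^ 2 := fun i j ω => by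
    rw [abs_mul, sq]
    exact mul_le_mul (hb i ω) (hb j ω) (abs_nonneg _) ((abs_nonneg _).trans (hb i ω))
  have hint : ∀ i j, Integrable (fun ω => ξ i ω * ξ j ω) P := fun i j =>
    .of_bound ((mξ i).mul (mξ j)).aestronglyMeasurable (C ^ 2)
      (ae_of_all _ fun ω => (Real.norm_eq_abs _).trans_le (hprod i j ω))
  have hle : ∀ i j, ∫ ω, ξ i ω * ξ j ω ∂P ≤ if i < j + m ∧ j < i + m then C ^ 2 else 0 := by
    intro i j
    split_ifs with h
    · refine (le_abs_self _).trans ?_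
      simpa using norm_integral_le_of_norm_le_const (μ := P)
        (ae_of_all _ fun ω => (Real.norm_eq_abs _).trans_le (hprod i j ω))
    · rcases not_and_or.1 h with h | h
      · simp_rw [mul_comm (ξ i _)]
        exact (h0 j i (not_lt.1 h)).le
      · exact (h0 i j (not_lt.1 h)).le
  simp_rw [sq, Finset.sum_mul_sum]
  rw [integral_finsetSum _ fun i _ => integrable_finsetSum _ fun j _ => hint i j]
  simp_rw [integral_finsetSum _ fun j _ => hint _ j]
  rw [← nsmul_eq_mul]
  refine Finset.sum_le_card_nsmul _ _ _ fun i _ => (Finset.sum_le_sum fun j _ => hle i j).trans ?_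
  rw [← Finset.sum_filter, Finset.sum_const, nsmul_eq_mul, ← sq]
  refine mul_le_mul_of_nonneg_right ?_ (sq_nonneg C)
  have : (A.filter fun j => i < j + m ∧ j < i + m) ⊆ Finset.Ico (i - m) (i + m) := by
    intro j hj
    simp only [Finset.mem_filter, Finset.mem_Ico] at hj ⊢
    omega
  have hc := Finset.card_le_card this
  rw [Nat.card_Ico] at hc
  exact_mod_cast hc.trans (by omega)

theorem norm_charFun_map_sub_le {Ω : Type*} {mΩ : MeasurableSpace Ω} {P : Measure Ω}
    [IsProbabilityMeasure P] {X Y : Ω → ℝ} (hX : AEMeasurable X P) (hY : AEMeasurable Y P)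
    (h2 : MemLp (X - Y) 2 P) (t : ℝ) :
    ‖charFun (P.map X) t - charFun (P.map Y) t‖ ≤ |t| * √(∫ ω, (X ω - Y ω) ^ 2 ∂P) := by
  have hexp : ∀ a b : ℝ, ‖Complex.exp (a * Complex.I) - Complex.exp (b * Complex.I)‖ ≤ |a - b| := by
    intro a b
    have : Complex.exp (a * Complex.I) - Complex.exp (b * Complex.I) =
        Complex.exp (b * Complex.I) * (Complex.exp (Complex.I * (a - b : ℝ)) - 1) := by
      rw [mul_sub, ← Complex.exp_add, mul_one]
      congr 2
      push_cast; ring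
    rw [this, norm_mul, Complex.norm_exp_ofReal_mul_I, one_mul]
    exact Real.norm_exp_I_mul_ofReal_sub_one_le
  have hint : ∀ Z : Ω → ℝ, AEMeasurable Z P →
      Integrable (fun ω => Complex.exp (t * Z ω * Complex.I)) P := fun Z hZ =>
    .of_bound (by fun_prop) 1 (ae_of_all _ fun ω => by
      rw [← Complex.ofReal_mul, Complex.norm_exp_ofReal_mul_I])
  have hI : Integrable (X - Y) P := h2.integrable (by norm_num)
  rw [charFun_apply_real, charFun_apply_real, integral_map hX (by fun_prop),
    integral_map hY (by fun_prop), ← integral_sub (hint X hX) (hint Y hY)]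
  calc _ ≤ ∫ ω, ‖Complex.exp (t * X ω * Complex.I) - Complex.exp (t * Y ω * Complex.I)‖ ∂P :=
        norm_integral_le_integral_norm _
    _ ≤ ∫ ω, |t| * |X ω - Y ω| ∂P := by
        refine integral_mono ((hint X hX).sub (hint Y hY)).norm (hI.abs.const_mul _) fun ω => ?_
        have := hexp (t * X ω) (t * Y ω)
        rw [← mul_sub, abs_mul] at this
        simpa using this
    _ = |t| * ∫ ω, |X ω - Y ω| ∂P := integral_const_mul _ _
    _ ≤ _ := by
        -- `(E|Z|)² ≤ E Z²` is the nonnegativity of the variance of `|Z|`.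
        refine mul_le_mul_of_nonneg_left (Real.le_sqrt_of_sq_le ?_) (abs_nonneg t)
        have hv := variance_nonneg (fun ω => |X ω - Y ω|) P
        rw [variance_eq_sub (X := fun ω => |X ω - Y ω|) h2.abs] at hv
        simpa using hv

/-- An `ε/3` argument. The approximation is needed only eventually in `n`, with a threshold
depending on `k`; in the application `k` governs the block length. -/
theorem tendsto_of_eventually_norm_sub_le {a l : ℕ → ℂ} {b : ℕ → ℕ → ℂ} {c : ℂ} {e : ℕ → ℝ}
    (h1 : ∀ k, ∀ᶠ n in atTop, ‖a n - b k n‖ ≤ e k) (he : Tendsto e atTop (nhds 0))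
    (hb : ∀ k, Tendsto (b k) atTop (nhds (l k))) (hl : Tendsto l atTop (nhds c)) :
    Tendsto a atTop (nhds c) := by
  rw [Metric.tendsto_nhds]
  intro ε hε
  obtain ⟨k, hk1, hk2⟩ := ((he.eventually_lt_const (show (0 : ℝ) < ε / 3 by positivity)).and
    (Metric.tendsto_nhds.1 hl (ε / 3) (by positivity))).exists
  filter_upwards [h1 k, Metric.tendsto_nhds.1 (hb k) (ε / 3) (by positivity)] with n h3 h4
  rw [← dist_eq_norm] at h3
  linarith [dist_triangle4 (a n) (b k n) (l k) c]

/-! ### Bernstein blocks -/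

theorem tendsto_natCast_div_const_div {N : ℕ} :
    Tendsto (fun T : ℕ => ((T / N : ℕ) : ℝ) / T) atTop (nhds (1 / N)) := by
  refine ((tendsto_nat_floor_mul_div_atTop (R := ℝ) (a := 1 / N) (by positivity)).comp
    tendsto_natCast_atTop_atTop).congr fun T => ?_
  simp only [Function.comp_apply]
  rw [one_div_mul_eq_div, Nat.floor_div_eq_div]

theorem tendsto_charFun_sum_range_div {Ω : Type*} {mΩ : MeasurableSpace Ω} {P : Measure Ω}
    [IsProbabilityMeasure P] {B : ℕ → Ω → ℝ} (hB : MemLp (B 0) 2 P) (h0 : ∫ ω, B 0 ω ∂P = 0)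
    (hind : iIndepFun B P) (hid : ∀ n, IdentDistrib (B n) (B 0) P P) {N : ℕ} (hN : N ≠ 0)
    (t : ℝ) :
    Tendsto (fun T : ℕ => charFun (P.map fun ω => (√(T : ℝ))⁻¹ *
        ∑ b ∈ Finset.range (T / N), B b ω) t) atTop
      (nhds (Complex.exp (-((((∫ ω, B 0 ω ^ 2 ∂P) / N : ℝ) : ℂ) * t ^ 2 / 2)))) := by
  have h := tendstoInDistribution_inv_sqrt_mul_sum_sub (Y := id) HasLaw.id hB hind hid
  have h' : TendstoInDistribution (fun (T : ℕ) ω => (√((T / N : ℕ) : ℝ))⁻¹ *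
      (∑ k ∈ Finset.range (T / N), B k ω - ((T / N : ℕ) : ℝ) * ∫ ω, B 0 ω ∂P)) atTop id (fun _ => P)
      (gaussianReal 0 Var[B 0; P].toNNReal) :=
    ⟨fun T => h.forall_aemeasurable (T / N), h.aemeasurable_limit,
      h.tendsto.comp (Nat.tendsto_div_const_atTop hN)⟩
  -- Slutsky: this deterministic factor converts the normalisation by the number of blocks into that
  -- by `T`.
  have hc : TendstoInMeasure P (fun (T : ℕ) (_ : Ω) => √(((T / N : ℕ) : ℝ) / T)) atTop
      (fun _ => √(1 / N)) :=
    tendstoInMeasure_of_tendsto_ae (fun _ => aestronglyMeasurable_const)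
      (ae_of_all _ fun _ => tendsto_natCast_div_const_div.sqrt)
  have h2 := h'.continuous_comp_prodMk_of_tendstoInMeasure_const
    (g := fun x : ℝ × ℝ => x.1 * x.2) (by fun_prop) hc (fun _ => aemeasurable_const)
  have h3 := ProbabilityMeasure.tendsto_iff_tendsto_charFun.1 h2.tendsto t
  have hvar : Var[B 0; P] = ∫ ω, B 0 ω ^ 2 ∂P :=
    variance_of_integral_eq_zero hB.aestronglyMeasurable.aemeasurable h0
  convert h3 using 2
  · rename_i T
    simp only [ProbabilityMeasure.coe_mk]
    congr 2
    ext ω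
    rw [h0, mul_zero, sub_zero, Real.sqrt_div (Nat.cast_nonneg _)]
    rcases Nat.eq_zero_or_pos (T / N) with h | h
    · simp [h]
    · have : √((T / N : ℕ) : ℝ) ≠ 0 := (Real.sqrt_pos.2 (by exact_mod_cast h)).ne'
      field_simp
  · simp only [ProbabilityMeasure.coe_mk, id]
    rw [gaussianReal_map_mul_const, charFun_gaussianReal, hvar]
    have h0' : 0 ≤ ∫ ω, B 0 ω ^ 2 ∂P := integral_nonneg fun ω => sq_nonneg _
    have hs : (√(1 / (N : ℝ))) ^ 2 = 1 / N := Real.sq_sqrt (by positivity)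
    simp only [NNReal.coe_mul, NNReal.coe_mk, Real.coe_toNNReal _ h0', hs]
    push_cast
    congr 1
    ring

/-- `A` collects the gaps and the incomplete last period. It is chosen before `g`, so one set serves
every `ω`. -/
theorem exists_finset_sum_range_sub_sum_blocks {L N : ℕ} (hL : L ≤ N) (T : ℕ) :
    ∃ A : Finset ℕ, A.card = T - T / N * L ∧ ∀ g : ℕ → ℝ,
      ∑ i ∈ Finset.range T, g i - ∑ b ∈ Finset.range (T / N), ∑ i ∈ Finset.range L, g (b * N + i)
        = ∑ i ∈ A, g i := by
  have hinj : Set.InjOn (fun p : ℕ × ℕ => p.1 * N + p.2)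
      (Finset.range (T / N) ×ˢ Finset.range L : Finset (ℕ × ℕ)) := by
    rintro ⟨b, i⟩ hb ⟨b', i'⟩ hb' h
    simp only [Finset.coe_product, Finset.coe_range, Set.mem_prod, Set.mem_Iio] at hb hb' h
    have h1 : b = b' := by
      have e1 : (b * N + i) / N = b := by
        rw [mul_comm, Nat.mul_add_div (by omega), Nat.div_eq_of_lt (by omega), add_zero]
      have e2 : (b' * N + i') / N = b' := by
        rw [mul_comm, Nat.mul_add_div (by omega), Nat.div_eq_of_lt (by omega), add_zero]
      rw [← e1, ← e2, h]
    subst h1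
    simpa using h
  have hsub : (Finset.range (T / N) ×ˢ Finset.range L).image (fun p : ℕ × ℕ => p.1 * N + p.2) ⊆
      Finset.range T := by
    intro x hx
    simp only [Finset.mem_image, Finset.mem_product, Finset.mem_range, Prod.exists] at hx ⊢
    obtain ⟨b, i, ⟨hb, hi⟩, rfl⟩ := hx
    have h1 : (b + 1) * N ≤ T / N * N := Nat.mul_le_mul_right N hb
    have h2 := Nat.div_mul_le_self T N
    rw [add_mul] at h1
    omega
  refine ⟨Finset.range T \ (Finset.range (T / N) ×ˢ Finset.range L).image
    (fun p : ℕ × ℕ => p.1 * N + p.2), ?_, fun g => ?_⟩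
  · rw [Finset.card_sdiff_of_subset hsub, Finset.card_image_of_injOn hinj]
    simp
  · rw [← Finset.sum_sdiff hsub, Finset.sum_image hinj, Finset.sum_product]
    ring

/-- Central limit theorem for bounded functionals of finite windows of an iid sequence. -/
theorem tendstoInDistribution_sum_window {Ω E : Type*} {mΩ : MeasurableSpace Ω} {P : Measure Ω}
    [IsProbabilityMeasure P] {mE : MeasurableSpace E} {W : ℕ → Ω → E} (hW : iIndepFun W P)
    (mW : ∀ n, Measurable (W n)) (hid : ∀ n, IdentDistrib (W n) (W 0) P P)
    {f : (ℕ → E) → ℝ} (hf : Measurable f) {m : ℕ} (hloc : DependsOn f (Set.Iio m)) {C : ℝ}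
    (hC : ∀ w, |f w| ≤ C) (h0 : ∫ ω, f (fun k => W k ω) ∂P = 0) {v : ℝ≥0}
    (hv : Tendsto (fun L : ℕ => (∫ ω, (∑ i ∈ Finset.range L, f (fun k => W (i + k) ω)) ^ 2 ∂P) / L)
      atTop (nhds v)) :
    TendstoInDistribution (fun (T : ℕ) ω => (√(T : ℝ))⁻¹ *
      ∑ i ∈ Finset.range T, f (fun k => W (i + k) ω)) atTop (fun z : ℝ => z) (fun _ => P)
      (gaussianReal 0 v) := by
  set ξ : ℕ → Ω → ℝ := fun i ω => f (fun k => W (i + k) ω) with hξ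
  have mξ : ∀ n, Measurable (ξ n) := fun n => hf.comp (measurable_pi_lambda _ fun k => mW _)
  have bξ : ∀ n ω, |ξ n ω| ≤ C := fun n ω => hC _
  have meanξ : ∀ n, ∫ ω, ξ n ω ∂P = 0 := fun n => by
    have := ((identDistrib_shift hW hid n 0).comp hf).integral_eq
    simp only [Function.comp_def, zero_add] at this
    rw [← h0, ← this]
  -- The windows starting at `i` and `j` are disjoint, so the expectation factors into zero means.
  have far : ∀ i j, i + m ≤ j → ∫ ω, ξ i ω * ξ j ω ∂P = 0 := fun i j hij => by
    have hI := (iIndepFun_windows hW mW hf hloc (s := fun b : Bool => if b then i else j)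
      (by rintro (_ | _) (_ | _) h <;> simp_all)).indepFun (i := true) (j := false) (by simp)
    have := hI.integral_mul_eq_mul_integral (mξ i).aestronglyMeasurable (mξ j).aestronglyMeasurable
    exact this.trans (mul_eq_zero_of_left (meanξ i) _)
  have mS : ∀ T : ℕ, Measurable fun ω => (√(T : ℝ))⁻¹ * ∑ i ∈ Finset.range T, ξ i ω :=
    fun T => by fun_prop
  have bdd : ∀ {Z : Ω → ℝ} (K : ℝ), Measurable Z → (∀ ω, |Z ω| ≤ K) → MemLp Z 2 P :=
    fun K hZ hK => .of_bound hZ.aestronglyMeasurable K (ae_of_all _ hK)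
  have bsum : ∀ (A : Finset ℕ) (ω), |∑ i ∈ A, ξ i ω| ≤ A.card * C := fun A ω => by
    refine (Finset.abs_sum_le_sum_abs _ _).trans ?_
    rw [← nsmul_eq_mul]
    exact Finset.sum_le_card_nsmul _ _ _ fun i _ => bξ i ω
  refine ⟨fun T => (mS T).aemeasurable, by fun_prop, ?_⟩
  refine ProbabilityMeasure.tendsto_iff_tendsto_charFun.2 fun t => ?_
  simp only [ProbabilityMeasure.coe_mk, Measure.map_id']
  rw [charFun_gaussianReal]
  let V : ℕ → ℝ := fun L => ∫ ω, (∑ i ∈ Finset.range L, ξ i ω) ^ 2 ∂P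
  -- A period is a block of `L + 1` terms followed by a gap of `m`; the `+ 1` keeps the block
  -- nonempty and `N L` positive.
  let N : ℕ → ℕ := fun L => L + 1 + m
  let B : ℕ → ℕ → Ω → ℝ := fun L b ω => ∑ i ∈ Finset.range (L + 1), ξ (b * N L + i) ω
  have mB : ∀ L b, Measurable (B L b) := fun L b => by fun_prop
  have hN0 : ∀ L, (0 : ℝ) < N L := fun L => by simp only [N]; positivity
  refine tendsto_of_eventually_norm_sub_le
    (b := fun L T => charFun (P.map fun ω => (√(T : ℝ))⁻¹ *
      ∑ b ∈ Finset.range (T / N L), B L b ω) t)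
    (l := fun L => Complex.exp (-(((V (L + 1) / N L : ℝ) : ℂ) * t ^ 2 / 2)))
    (e := fun L => |t| * √((m + 1) / N L * (2 * m * C ^ 2))) ?_ ?_ ?_ ?_
  · intro L
    -- The gaps contribute at most `T m / N` discarded indices and the last period at most `N ≤ T /
    -- N`; this is the source of the factor `(m + 1) / N` in `e`.
    filter_upwards [eventually_ge_atTop (N L * N L)] with T hT
    have hTpos : (0 : ℝ) < T := by
      have : 0 < N L * N L := by simp only [N]; positivity
      exact_mod_cast this.trans_le hT
    obtain ⟨A, hA, hsum⟩ := exists_finset_sum_range_sub_sum_blocks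
      (show L + 1 ≤ N L by simp only [N]; omega) T
    have hdiff : ∀ ω, (√(T : ℝ))⁻¹ * ∑ i ∈ Finset.range T, ξ i ω -
        (√(T : ℝ))⁻¹ * ∑ b ∈ Finset.range (T / N L), B L b ω = (√(T : ℝ))⁻¹ * ∑ i ∈ A, ξ i ω :=
      fun ω => by rw [← mul_sub, hsum fun i => ξ i ω]
    refine (norm_charFun_map_sub_le (mS T).aemeasurable (by fun_prop) ?_ t).trans ?_
    · refine (bdd ((√(T : ℝ))⁻¹ * (A.card * C)) (by fun_prop) fun ω => ?_)
      rw [Pi.sub_apply, hdiff, abs_mul, abs_of_nonneg (by positivity)]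
      exact mul_le_mul_of_nonneg_left (bsum A ω) (by positivity)
    · refine mul_le_mul_of_nonneg_left (Real.sqrt_le_sqrt ?_) (abs_nonneg t)
      simp_rw [hdiff, mul_pow, integral_const_mul, inv_pow, Real.sq_sqrt hTpos.le]
      have hcard : (A.card : ℝ) ≤ T * ((m + 1) / N L) := by
        rw [← mul_div_assoc, le_div_iff₀ (hN0 L)]
        have h1 : T < (T / N L + 1) * N L := by
          rw [mul_comm]
          exact Nat.lt_mul_div_succ T (by simp only [N]; omega)
        have h2 : A.card ≤ T / N L * m + N L := by
          rw [hA]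
          have : T / N L * N L = T / N L * (L + 1) + T / N L * m := by simp only [N]; ring
          rw [add_mul] at h1
          omega
        have h3 : A.card * N L ≤ T * (m + 1) := by
          calc A.card * N L ≤ (T / N L * m + N L) * N L := Nat.mul_le_mul_right _ h2
            _ = (T / N L * N L) * m + N L * N L := by ring
            _ ≤ T * m + T := Nat.add_le_add (Nat.mul_le_mul_right _ (Nat.div_mul_le_self _ _)) hT
            _ = _ := by ring
        exact_mod_cast h3
      rw [inv_mul_le_iff₀ hTpos, ← mul_assoc]
      exact (integral_sq_sum_le mξ bξ far A).trans
        (mul_le_mul_of_nonneg_right hcard (by positivity))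
  · have h1 : Tendsto (fun L => ((m : ℝ) + 1) / N L) atTop (nhds 0) :=
      tendsto_const_nhds.div_atTop (tendsto_natCast_atTop_atTop.comp
        (tendsto_atTop_mono (fun L => by simp only [N, id]; omega) tendsto_id))
    simpa using ((h1.mul_const (2 * m * C ^ 2)).sqrt).const_mul |t|
  · intro L
    let g : (ℕ → E) → ℝ := fun w => ∑ i ∈ Finset.range (L + 1), f fun k => w (i + k)
    have hg : Measurable g := Finset.measurable_sum _ fun i _ =>
      hf.comp (measurable_pi_lambda _ fun k => measurable_pi_apply _)
    have hgloc : DependsOn g (Set.Iio (N L)) := fun x y hxy =>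
      Finset.sum_congr rfl fun i hi => hloc fun k hk => hxy _ (by
        simp only [N, Set.mem_Iio, Finset.mem_range] at hi hk ⊢; omega)
    have hBg : ∀ b, B L b = fun ω => g fun k => W (b * N L + k) ω := fun b => by
      ext ω
      simp only [B, g, hξ, add_assoc]
    have hB0 : B L 0 = fun ω => ∑ i ∈ Finset.range (L + 1), ξ i ω := by
      ext ω
      simp only [B, zero_mul, zero_add]
    have hint : ∀ i, Integrable (ξ i) P := fun i => (bdd C (mξ i) (bξ i)).integrable (by norm_num)
    have := tendsto_charFun_sum_range_div (B := B L) (P := P) (N := N L) ?_ ?_ ?_ ?_ ?_ t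
    · rw [hB0] at this
      exact this
    · rw [hB0]
      exact bdd _ (by fun_prop) (bsum _)
    · rw [hB0, integral_finsetSum _ fun i _ => hint i]
      simp [meanξ]
    · simp_rw [funext hBg]
      refine iIndepFun_windows hW mW hg hgloc fun b b' hne => ?_
      rcases lt_or_gt_of_ne hne with h | h
      · exact .inl (by nlinarith [Nat.mul_le_mul_right (N L) h])
      · exact .inr (by nlinarith [Nat.mul_le_mul_right (N L) h])
    · intro n
      simp_rw [hBg]
      exact (identDistrib_shift hW hid _ _).comp hg
    · simp only [N]; omega
  · have h1 : Tendsto (fun L => V (L + 1) / N L) atTop (nhds v) := by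
      have h2 := (tendsto_add_atTop_iff_nat 1).2 hv
      have h3 : Tendsto (fun L : ℕ => ((L + 1 : ℕ) : ℝ) / N L) atTop (nhds 1) := by
        have := tendsto_natCast_div_add_atTop (𝕜 := ℝ) (m : ℝ)
        refine ((tendsto_add_atTop_iff_nat 1).2 this).congr fun L => ?_
        simp [N]
      have h4 := h2.mul h3
      rw [mul_one] at h4
      refine h4.congr fun L => ?_
      have : ((L + 1 : ℕ) : ℝ) ≠ 0 := by positivity
      simp only [V, hξ]
      field_simp
    have hcont : Continuous fun x : ℝ => Complex.exp (-((x : ℂ) * t ^ 2 / 2)) := by fun_prop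
    refine ((hcont.tendsto v).comp h1).congr' ?_ |>.trans ?_
    · exact .of_forall fun L => rfl
    · simp

/-! ### Independent pairs -/

theorem iIndepFun_bool {Ω : Type*} {mΩ : MeasurableSpace Ω} {P : Measure Ω}
    [IsProbabilityMeasure P] {𝓧 : Bool → Type*} {m𝓧 : ∀ b, MeasurableSpace (𝓧 b)}
    {X : (b : Bool) → Ω → 𝓧 b} (h : IndepFun (X true) (X false) P) : iIndepFun X P := by
  rw [iIndepFun_iff_measure_inter_preimage_eq_mul]
  have hS : ∀ S : Finset Bool, S = ∅ ∨ S = {true} ∨ S = {false} ∨ S = {true, false} := by decide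
  intro S s hs
  rcases hS S with rfl | rfl | rfl | rfl
  · simp
  · simp
  · simp
  · rw [Finset.set_biInter_insert, Finset.set_biInter_singleton, Finset.prod_pair (by simp)]
    exact h.measure_inter_preimage_eq_mul _ _ (hs true (by simp)) (hs false (by simp))

/-- Two independent sequences of independent variables give a sequence of independent pairs. -/
theorem iIndepFun_cond {Ω E : Type*} {mΩ : MeasurableSpace Ω} {P : Measure Ω}
    [IsProbabilityMeasure P] {mE : MeasurableSpace E} {x y : ℕ → Ω → E}
    (mx : ∀ n, Measurable (x n)) (my : ∀ n, Measurable (y n)) (hx : iIndepFun x P)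
    (hy : iIndepFun y P) (hxy : IndepFun (fun ω n => x n ω) (fun ω n => y n ω) P) :
    iIndepFun (fun n ω (b : Bool) => cond b (x n ω) (y n ω)) P := by
  have h1 : iIndepFun (fun (p : (_ : Bool) × ℕ) ω => cond p.1 (x p.2 ω) (y p.2 ω)) P :=
    iIndepFun_uncurry (X := fun (b : Bool) (n : ℕ) ω => cond b (x n ω) (y n ω))
      (by rintro (_ | _) n <;> simp [mx, my]) (iIndepFun_bool hxy)
      (by rintro (_ | _) <;> assumption)
  have h2 := h1.precomp (g := fun p : (_ : ℕ) × Bool => ⟨p.2, p.1⟩) (by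
    rintro ⟨a, b⟩ ⟨c, d⟩ h
    simp only [Sigma.mk.injEq, heq_eq_eq] at h ⊢
    exact ⟨h.2, h.1⟩)
  exact iIndepFun_sigma_curry (X := fun (n : ℕ) (b : Bool) ω => cond b (x n ω) (y n ω))
    (by rintro n (_ | _) <;> simp [mx, my]) h2

/-! ### Limit variance and covariances of row sums -/

/-- The expression in `h` is the increment of the second moment from `L` to `L + 1`. It is
eventually constant, so its Cesàro means converge to that constant. -/
theorem tendsto_integral_sq_sum_range_div {Ω : Type*} {mΩ : MeasurableSpace Ω} {P : Measure Ω}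
    {ξ : ℕ → Ω → ℝ} (hint : ∀ i j, Integrable (fun ω => ξ i ω * ξ j ω) P) {γ : ℝ} {M : ℕ}
    (h : ∀ L, M ≤ L → ∫ ω, ξ L ω * ξ L ω ∂P +
      2 * ∑ i ∈ Finset.range L, ∫ ω, ξ i ω * ξ L ω ∂P = γ) :
    Tendsto (fun L : ℕ => (∫ ω, (∑ i ∈ Finset.range L, ξ i ω) ^ 2 ∂P) / L) atTop (nhds γ) := by
  have hsum : ∀ L : ℕ, ∫ ω, (∑ i ∈ Finset.range L, ξ i ω) ^ 2 ∂P =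
      ∑ l ∈ Finset.range L, (∫ ω, ξ l ω * ξ l ω ∂P +
        2 * ∑ i ∈ Finset.range l, ∫ ω, ξ i ω * ξ l ω ∂P) := by
    intro L
    induction L with
    | zero => simp
    | succ L ih =>
      have hsq : Integrable (fun ω => (∑ i ∈ Finset.range L, ξ i ω) ^ 2) P := by
        simp_rw [sq, Finset.sum_mul_sum]
        exact integrable_finsetSum _ fun i _ => integrable_finsetSum _ fun j _ => hint i j
      have hcross : Integrable (fun ω => ∑ i ∈ Finset.range L, ξ i ω * ξ L ω) P :=
        integrable_finsetSum _ fun i _ => hint i L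
      have hlast : Integrable (fun ω => ξ L ω * ξ L ω +
          2 * ∑ i ∈ Finset.range L, ξ i ω * ξ L ω) P := (hint L L).add (hcross.const_mul 2)
      rw [Finset.sum_range_succ, ← ih, ← integral_finsetSum _ fun i _ => hint i L,
        ← integral_const_mul, ← integral_add (hint L L) (hcross.const_mul 2),
        ← integral_add hsq hlast]
      congr 1
      ext ω
      rw [Finset.sum_range_succ, ← Finset.sum_mul]
      ring
  have := (tendsto_const_nhds (x := γ)).congr' (f₂ := fun L => ∫ ω, ξ L ω * ξ L ω ∂P +
      2 * ∑ i ∈ Finset.range L, ∫ ω, ξ i ω * ξ L ω ∂P)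
    (by filter_upwards [eventually_ge_atTop M] with L hL using (h L hL).symm)
  refine this.cesaro.congr fun L => ?_
  rw [hsum, inv_mul_eq_div]

/-- The diagonal `k = d + l` meets the `m × m` square in `m - d` points, none once `d ≥ m`;
truncated subtraction covers both cases. -/
theorem sum_sum_range_ite_eq_add (m d : ℕ) (a b : ℝ) :
    ∑ k ∈ Finset.range m, ∑ l ∈ Finset.range m, (if k = d + l then a else b) =
      m ^ 2 * b + (a - b) * (m - d : ℕ) := by
  have h1 : ∀ k l : ℕ, (if k = d + l then a else b) = b + if k = d + l then a - b else 0 := by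
    intro k l; split_ifs <;> ring
  simp_rw [h1, Finset.sum_add_distrib]
  congr 1
  · simp; ring
  · rw [Finset.sum_comm]
    simp_rw [Finset.sum_ite_eq', Finset.mem_range]
    rw [← Finset.sum_filter, Finset.sum_const, nsmul_eq_mul, mul_comm]
    congr 2
    rw [show (Finset.range m).filter (fun l => d + l < m) = Finset.range (m - d) by
      ext l; simp only [Finset.mem_filter, Finset.mem_range]; omega, Finset.card_range]

/-- Only lags `L - i` below `m` contribute, and `m ≤ L` ensures that all of them occur, leaving `0 +
1 + ⋯ + (m - 1)`. -/
theorem two_mul_sum_range_tsub {m L : ℕ} (h : m ≤ L) :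
    2 * ∑ i ∈ Finset.range L, ((m - (L - i) : ℕ) : ℝ) = m * (m - 1) := by
  have h1 : ∑ i ∈ Finset.range L, (m - (L - i)) = ∑ r ∈ Finset.range m, r := by
    obtain ⟨c, rfl⟩ := Nat.exists_eq_add_of_le' h
    rw [Finset.sum_range_add, Finset.sum_eq_zero, zero_add]
    · exact Finset.sum_congr rfl fun r hr => by have := Finset.mem_range.1 hr; omega
    · intro i hi
      have := Finset.mem_range.1 hi; omega
  rw [← Nat.cast_sum, h1]
  have h2 := Finset.sum_range_id_mul_two m
  rcases m with _ | m
  · simp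
  · have : ((∑ r ∈ Finset.range (m + 1), r : ℕ) : ℝ) * 2 = (m + 1) * m := by exact_mod_cast h2
    push_cast at this ⊢
    linarith

/-- First moments of the row sums of a band. -/
theorem integral_mul_sum_range {Ω : Type*} {mΩ : MeasurableSpace Ω} {P : Measure Ω}
    [IsProbabilityMeasure P] {U V : ℕ → Ω → ℝ} (mU : ∀ n, Measurable (U n))
    (mV : ∀ n, Measurable (V n)) (bV : ∀ n ω, |V n ω| ≤ 1)
    (hUV : IndepFun (fun ω n => U n ω) (fun ω n => V n ω) P) {p q : ℝ}
    (eU : ∀ n, ∫ ω, U n ω ∂P = p) (eV : ∀ n, ∫ ω, V n ω ∂P = q) (m c a : ℕ) :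
    ∫ ω, U c ω * ∑ k ∈ Finset.range m, V (a + k) ω ∂P = m * p * q := by
  rw [hUV.integral_fun_comp_mul_comp (f := fun u => u c)
    (g := fun v => ∑ k ∈ Finset.range m, v (a + k)) (measurable_pi_lambda _ mU).aemeasurable
    (measurable_pi_lambda _ mV).aemeasurable (measurable_pi_apply c).aestronglyMeasurable
    (Measurable.aestronglyMeasurable (by fun_prop)), eU,
    integral_finsetSum _ fun k _ =>
      .of_bound (mV _).aestronglyMeasurable 1 (ae_of_all _ (bV _))]
  simp only [eV, Finset.sum_const, Finset.card_range, nsmul_eq_mul]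
  ring

/-- Second moments of the centred row sums of a band. -/
theorem integral_rowSum_mul_rowSum {Ω : Type*} {mΩ : MeasurableSpace Ω} {P : Measure Ω}
    [IsProbabilityMeasure P] {U V : ℕ → Ω → ℝ} (mU : ∀ n, Measurable (U n))
    (mV : ∀ n, Measurable (V n)) (bU : ∀ n ω, |U n ω| ≤ 1) (bV : ∀ n ω, |V n ω| ≤ 1)
    (hUV : IndepFun (fun ω n => U n ω) (fun ω n => V n ω) P) {p q : ℝ}
    (eU : ∀ n, ∫ ω, U n ω ∂P = p) (eV : ∀ n, ∫ ω, V n ω ∂P = q)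
    (eVV : ∀ i j, ∫ ω, V i ω * V j ω ∂P = if i = j then q else q ^ 2) (m δ i d : ℕ) :
    ∫ ω, (U (i + δ) ω * ∑ k ∈ Finset.range m, V (i + k) ω - m * p * q) *
        (U (i + d + δ) ω * ∑ k ∈ Finset.range m, V (i + d + k) ω - m * p * q) ∂P =
      (∫ ω, U (i + δ) ω * U (i + d + δ) ω ∂P) * (m ^ 2 * q ^ 2 + (q - q ^ 2) * (m - d : ℕ))
        - m ^ 2 * p ^ 2 * q ^ 2 := by
  have bm : ∀ {a b : ℝ}, |a| ≤ 1 → |b| ≤ 1 → |a * b| ≤ 1 := fun ha hb => by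
    rw [abs_mul]; exact mul_le_one₀ ha (abs_nonneg _) hb
  have iVV : ∀ a b, Integrable (fun ω => V a ω * V b ω) P := fun a b =>
    .of_bound ((mV a).mul (mV b)).aestronglyMeasurable 1
      (ae_of_all _ fun ω => bm (bV a ω) (bV b ω))
  have mUseq : Measurable fun ω n => U n ω := measurable_pi_lambda _ mU
  have mVseq : Measurable fun ω n => V n ω := measurable_pi_lambda _ mV
  have hprod : ∀ g h : (ℕ → ℝ) → ℝ, Measurable g → Measurable h →
      ∫ ω, g (fun n => U n ω) * h (fun n => V n ω) ∂P =
        (∫ ω, g (fun n => U n ω) ∂P) * ∫ ω, h (fun n => V n ω) ∂P := fun g h hg hh =>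
    hUV.integral_fun_comp_mul_comp mUseq.aemeasurable mVseq.aemeasurable
      hg.aestronglyMeasurable hh.aestronglyMeasurable
  have e1 := integral_mul_sum_range mU mV bV hUV eU eV m
  have i1 : ∀ c a, Integrable (fun ω => U c ω * ∑ k ∈ Finset.range m, V (a + k) ω) P :=
    fun c a => by
      simp_rw [Finset.mul_sum]
      exact integrable_finsetSum _ fun k _ =>
        .of_bound ((mU _).mul (mV _)).aestronglyMeasurable 1
          (ae_of_all _ fun ω => bm (bU _ ω) (bV _ ω))
  have e2 : ∀ c c' a a', ∫ ω, (U c ω * U c' ω) *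
      ((∑ k ∈ Finset.range m, V (a + k) ω) * ∑ k ∈ Finset.range m, V (a' + k) ω) ∂P =
      (∫ ω, U c ω * U c' ω ∂P) * ∑ k ∈ Finset.range m, ∑ l ∈ Finset.range m,
        if a + k = a' + l then q else q ^ 2 := fun c c' a a' => by
    rw [hprod (fun u => u c * u c') (fun v => (∑ k ∈ Finset.range m, v (a + k)) *
      ∑ k ∈ Finset.range m, v (a' + k)) (by fun_prop) (by fun_prop)]
    simp_rw [Finset.sum_mul_sum]
    rw [integral_finsetSum _ fun i _ => integrable_finsetSum _ fun j _ => iVV _ _]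
    simp_rw [integral_finsetSum _ fun j _ => iVV _ _, eVV]
  have i2 : ∀ c c' a a', Integrable (fun ω => (U c ω * U c' ω) *
      ((∑ k ∈ Finset.range m, V (a + k) ω) * ∑ k ∈ Finset.range m, V (a' + k) ω)) P :=
    fun c c' a a' => by
      simp_rw [Finset.sum_mul_sum, Finset.mul_sum]
      exact integrable_finsetSum _ fun k _ => integrable_finsetSum _ fun l _ =>
        .of_bound (by fun_prop) 1
          (ae_of_all _ fun ω => bm (bm (bU _ ω) (bU _ ω)) (bm (bV _ ω) (bV _ ω)))
  have hexp : ∀ ω, (U (i + δ) ω * ∑ k ∈ Finset.range m, V (i + k) ω - m * p * q) *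
        (U (i + d + δ) ω * ∑ k ∈ Finset.range m, V (i + d + k) ω - m * p * q) =
      (U (i + δ) ω * U (i + d + δ) ω) * ((∑ k ∈ Finset.range m, V (i + k) ω) *
        ∑ k ∈ Finset.range m, V (i + d + k) ω) -
      ((m * p * q) * (U (i + δ) ω * ∑ k ∈ Finset.range m, V (i + k) ω) +
        (m * p * q) * (U (i + d + δ) ω * ∑ k ∈ Finset.range m, V (i + d + k) ω) -
          (m * p * q) ^ 2) := fun ω => by ring
  have lin : ∀ {A B D : Ω → ℝ} (c : ℝ), Integrable A P → Integrable B P → Integrable D P →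
      ∫ ω, (A ω - (c * B ω + c * D ω - c ^ 2)) ∂P =
        ∫ ω, A ω ∂P - (c * ∫ ω, B ω ∂P + c * ∫ ω, D ω ∂P - c ^ 2) := fun {A B D} c hA hB hD => by
    have h1 : Integrable (fun ω => c * B ω + c * D ω) P := (hB.const_mul c).add (hD.const_mul c)
    have h2 : Integrable (fun ω => c * B ω + c * D ω - c ^ 2) P := h1.sub (integrable_const _)
    rw [integral_sub hA h2, integral_sub h1 (integrable_const _),
      integral_add (hB.const_mul c) (hD.const_mul c), integral_const_mul, integral_const_mul]
    simp
  simp_rw [hexp]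
  rw [lin _ (i2 _ _ _ _) (i1 _ _) (i1 _ _), e2, e1, e1]
  -- Cancelling `i` turns the coincidence of `V`-indices into `k = d + l`, so the result depends on
  -- the lag alone.
  simp_rw [add_assoc i, add_right_inj]
  rw [sum_sum_range_ite_eq_add]
  ring

/-! ### Marks as indicators, and the boundary of the band -/

/-- The indicator of the value `1`. -/
noncomputable def markInd (x : ℝ) : ℝ := Set.indicator {1} 1 x

theorem markInd_nonneg (x : ℝ) : 0 ≤ markInd x := Set.indicator_nonneg (by simp) x

theorem markInd_le_one (x : ℝ) : markInd x ≤ 1 :=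
  Set.indicator_le_self' (by simp) x

theorem abs_markInd_le_one (x : ℝ) : |markInd x| ≤ 1 := by
  rw [abs_of_nonneg (markInd_nonneg x)]; exact markInd_le_one x

theorem markInd_mul_self (x : ℝ) : markInd x * markInd x = markInd x := by
  by_cases h : x = 1 <;> simp [markInd, h]

@[fun_prop]
theorem measurable_markInd : Measurable markInd :=
  measurable_one.indicator (measurableSet_singleton 1)

theorem integral_markInd_of_hasLaw {Ω : Type*} {mΩ : MeasurableSpace Ω} {P : Measure Ω} {p : I}
    {x : Ω → ℝ} (h : HasLaw x (bernoulliMeasure (1 : ℝ) 0 p) P) :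
    ∫ ω, markInd (x ω) ∂P = p := by
  have := h.integral_comp (f := markInd) measurable_markInd.aestronglyMeasurable
  rw [Function.comp_def] at this
  rw [this, integral_bernoulliMeasure]
  simp [markInd]

theorem integral_markInd_mul_markInd {Ω : Type*} {mΩ : MeasurableSpace Ω} {P : Measure Ω} {p : I}
    {x : ℕ → Ω → ℝ} (h : ∀ n, HasLaw (x n) (bernoulliMeasure (1 : ℝ) 0 p) P)
    (hind : iIndepFun x P) (i j : ℕ) :
    ∫ ω, markInd (x i ω) * markInd (x j ω) ∂P = if i = j then (p : ℝ) else (p : ℝ) ^ 2 := by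
  split_ifs with hij
  · subst hij
    simp_rw [markInd_mul_self]
    exact integral_markInd_of_hasLaw (h i)
  · rw [(hind.indepFun hij).integral_fun_comp_mul_comp (h i).aemeasurable (h j).aemeasurable
      measurable_markInd.aestronglyMeasurable measurable_markInd.aestronglyMeasurable,
      integral_markInd_of_hasLaw (h i), integral_markInd_of_hasLaw (h j), sq]

/-- The pairs `(i, j) ∈ {1, …, T}²` with `|i - j| ≤ δ`. -/
def band (T δ : ℕ) : Finset (ℕ × ℕ) :=
  {q ∈ Finset.Icc 1 T ×ˢ Finset.Icc 1 T | |(q.1 : ℤ) - (q.2 : ℤ)| ≤ (δ : ℤ)}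

theorem card_bandMarks (x y : ℕ → ℝ) (T δ : ℕ) :
    ((bandMarks x y T δ).card : ℝ) = ∑ q ∈ band T δ, markInd (x q.1) * markInd (y q.2) := by
  classical
  have : bandMarks x y T δ = (band T δ).filter fun q => x q.1 = 1 ∧ y q.2 = 1 := by
    ext q
    simp only [bandMarks, band, Finset.mem_filter, and_assoc]
  rw [this, Finset.card_filter]
  push_cast
  refine Finset.sum_congr rfl fun q _ => ?_
  by_cases h1 : x q.1 = 1 <;> by_cases h2 : y q.2 = 1 <;> simp [markInd, h1, h2]

/-- Common terms cancel, and the two remaining sums both lie in `[0, K]`, so the bound is `K` rather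
than `2K`. -/
theorem abs_sum_sub_sum_le {α : Type*} [DecidableEq α] {s t : Finset α} {h : α → ℝ}
    (h0 : ∀ a, 0 ≤ h a) (h1 : ∀ a, h a ≤ 1) {K : ℕ} (hs : (s \ t).card ≤ K)
    (ht : (t \ s).card ≤ K) : |∑ a ∈ s, h a - ∑ a ∈ t, h a| ≤ K := by
  have hle : ∀ u : Finset α, ∑ a ∈ u, h a ≤ u.card := fun u => by
    simpa using Finset.sum_le_card_nsmul u h 1 fun a _ => h1 a
  have hs' : ((s \ t).card : ℝ) ≤ K := by exact_mod_cast hs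
  have ht' : ((t \ s).card : ℝ) ≤ K := by exact_mod_cast ht
  rw [← Finset.sum_sdiff_sub_sum_sdiff, abs_le]
  have a1 := hle (s \ t)
  have a2 := hle (t \ s)
  have a3 := Finset.sum_nonneg fun a (_ : a ∈ s \ t) => h0 a
  have a4 := Finset.sum_nonneg fun a (_ : a ∈ t \ s) => h0 a
  constructor <;> linarith

/-- Up to a boundary term, the number of marks is a sum over full rows of the band. -/
theorem abs_card_bandMarks_sub_le (x y : ℕ → ℝ) (T δ : ℕ) :
    |((bandMarks x y T δ).card : ℝ) - ∑ n ∈ Finset.range T, markInd (x (n + δ + 1)) *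
      ∑ k ∈ Finset.range (2 * δ + 1), markInd (y (n + k + 1))| ≤
      ((2 * δ + 1) * (3 * δ + 1) : ℕ) := by
  -- Row `n` has `i = n + δ + 1`, and `j = n + k + 1` runs over `i - δ, …, i + δ`. The shift by `δ`
  -- keeps every `j` positive, so each row is full.
  have hinj : Set.InjOn (fun p : ℕ × ℕ => (p.1 + δ + 1, p.1 + p.2 + 1))
      (Finset.range T ×ˢ Finset.range (2 * δ + 1) : Finset (ℕ × ℕ)) := by
    rintro ⟨a, b⟩ - ⟨c, d⟩ - h
    simp only [Prod.mk.injEq] at h ⊢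
    omega
  have hsum : ∑ n ∈ Finset.range T, markInd (x (n + δ + 1)) *
      ∑ k ∈ Finset.range (2 * δ + 1), markInd (y (n + k + 1)) =
      ∑ q ∈ (Finset.range T ×ˢ Finset.range (2 * δ + 1)).image
        (fun p : ℕ × ℕ => (p.1 + δ + 1, p.1 + p.2 + 1)), markInd (x q.1) * markInd (y q.2) := by
    rw [Finset.sum_image hinj, Finset.sum_product]
    simp_rw [Finset.mul_sum]
  rw [card_bandMarks, hsum]
  refine abs_sum_sub_sum_le (fun q => mul_nonneg (markInd_nonneg _) (markInd_nonneg _))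
    (fun q => mul_le_one₀ (markInd_le_one _) (markInd_nonneg _) (markInd_le_one _)) ?_ ?_
  -- Band points missed by the full rows have `i ≤ δ`, hence `j ≤ 2δ`.
  · refine (Finset.card_le_card (t := Finset.Icc 1 δ ×ˢ Finset.Icc 1 (2 * δ)) ?_).trans ?_
    · rintro ⟨i, j⟩ hij
      simp only [band, Finset.mem_sdiff, Finset.mem_filter, Finset.mem_product, Finset.mem_Icc,
        Finset.mem_image, Finset.mem_range, Prod.exists, Prod.mk.injEq, abs_le, not_exists,
        not_and] at hij ⊢
      obtain ⟨⟨⟨hi, hj⟩, hd⟩, hn⟩ := hij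
      by_cases h : i ≤ δ
      · omega
      · exact absurd (show i - δ - 1 + (j + δ - i) + 1 = j by omega)
          (hn (i - δ - 1) (j + δ - i) (by omega) (by omega))
    · rw [Finset.card_product, Nat.card_Icc, Nat.card_Icc]
      simp only [Nat.add_sub_cancel]
      nlinarith
  -- Surplus points have `i > T` or `j > T`; since `|i - j| ≤ δ`, both coordinates are at least `T +
  -- 1 - δ`.
  · refine (Finset.card_le_card
      (t := Finset.Icc (T + 1 - δ) (T + δ) ×ˢ Finset.Icc (T + 1 - δ) (T + 2 * δ)) ?_).trans ?_
    · rintro ⟨i, j⟩ hij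
      simp only [band, Finset.mem_sdiff, Finset.mem_filter, Finset.mem_product, Finset.mem_Icc,
        Finset.mem_image, Finset.mem_range, Prod.exists, Prod.mk.injEq, abs_le] at hij ⊢
      obtain ⟨⟨a, b, hab, rfl, rfl⟩, hn⟩ := hij
      omega
    · rw [Finset.card_product, Nat.card_Icc, Nat.card_Icc]
      exact Nat.mul_le_mul (by omega) (by omega)

/-! ### The limit theorem for the marks -/

/-- The theorem for measurable (rather than a.e. measurable) variables. -/
theorem tendstoInDistribution_numMarks {Ω : Type*} [MeasurableSpace Ω] (P : Measure Ω)
    [IsProbabilityMeasure P] (pX pY : I) (X Y : ℕ → Ω → ℝ) (δ : ℕ)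
    (mX : ∀ n : ℕ, Measurable (X (n + 1))) (mY : ∀ n : ℕ, Measurable (Y (n + 1)))
    (hX_law : ∀ n : ℕ, HasLaw (X (n + 1)) (bernoulliMeasure (1 : ℝ) 0 pX) P)
    (hY_law : ∀ n : ℕ, HasLaw (Y (n + 1)) (bernoulliMeasure (1 : ℝ) 0 pY) P)
    (hX_indep : iIndepFun (fun n : ℕ => X (n + 1)) P)
    (hY_indep : iIndepFun (fun n : ℕ => Y (n + 1)) P)
    (hXY_indep : IndepFun (fun ω (n : ℕ) => X (n + 1) ω) (fun ω (n : ℕ) => Y (n + 1) ω) P) :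
    TendstoInDistribution
      (fun (T : ℕ) (ω : Ω) =>
        (numMarks X Y δ T ω - ∫ ω', numMarks X Y δ T ω' ∂P) / Real.sqrt (T : ℝ))
      atTop (fun z : ℝ => z) (fun _ => P) (gaussianReal 0 (sigmaSq pX pY δ).toNNReal) := by
  set m : ℕ := 2 * δ + 1 with hm
  set p : ℝ := (pX : ℝ)
  set q : ℝ := (pY : ℝ)
  let U : ℕ → Ω → ℝ := fun n ω => markInd (X (n + 1) ω)
  let V : ℕ → Ω → ℝ := fun n ω => markInd (Y (n + 1) ω)
  let W : ℕ → Ω → Bool → ℝ := fun n ω b => cond b (X (n + 1) ω) (Y (n + 1) ω)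
  let f : (ℕ → Bool → ℝ) → ℝ := fun w =>
    markInd (w δ true) * ∑ k ∈ Finset.range m, markInd (w k false) - m * p * q
  let ξ : ℕ → Ω → ℝ := fun n ω => U (n + δ) ω * ∑ k ∈ Finset.range m, V (n + k) ω - m * p * q
  have hξ : ∀ n ω, f (fun k => W (n + k) ω) = ξ n ω := fun n ω => rfl
  have mU : ∀ n, Measurable (U n) := fun n => measurable_markInd.comp (mX n)
  have mV : ∀ n, Measurable (V n) := fun n => measurable_markInd.comp (mY n)
  have bU : ∀ n ω, |U n ω| ≤ 1 := fun n ω => abs_markInd_le_one _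
  have bV : ∀ n ω, |V n ω| ≤ 1 := fun n ω => abs_markInd_le_one _
  have hUV : IndepFun (fun ω n => U n ω) (fun ω n => V n ω) P :=
    hXY_indep.comp (φ := fun u n => markInd (u n)) (ψ := fun u n => markInd (u n))
      (by fun_prop) (by fun_prop)
  have eU : ∀ n, ∫ ω, U n ω ∂P = p := fun n => integral_markInd_of_hasLaw (hX_law n)
  have eV : ∀ n, ∫ ω, V n ω ∂P = q := fun n => integral_markInd_of_hasLaw (hY_law n)
  have eUU : ∀ i j, ∫ ω, U i ω * U j ω ∂P = if i = j then p else p ^ 2 :=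
    integral_markInd_mul_markInd hX_law hX_indep
  have eVV : ∀ i j, ∫ ω, V i ω * V j ω ∂P = if i = j then q else q ^ 2 :=
    integral_markInd_mul_markInd hY_law hY_indep
  have mW : ∀ n, Measurable (W n) := fun n => measurable_pi_lambda _ (by
    rintro (_ | _)
    exacts [mY n, mX n])
  have hW : iIndepFun W P := iIndepFun_cond mX mY hX_indep hY_indep hXY_indep
  have hid : ∀ n, IdentDistrib (W n) (W 0) P P := fun n => by
    have hpair : ∀ k, IndepFun (X (k + 1)) (Y (k + 1)) P := fun k =>
      hXY_indep.comp (measurable_pi_apply k) (measurable_pi_apply k)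
    have h1 : IdentDistrib (X (n + 1)) (X (0 + 1)) P P :=
      ⟨(mX n).aemeasurable, (mX 0).aemeasurable, (hX_law n).map_eq.trans (hX_law 0).map_eq.symm⟩
    have h2 : IdentDistrib (Y (n + 1)) (Y (0 + 1)) P P :=
      ⟨(mY n).aemeasurable, (mY 0).aemeasurable, (hY_law n).map_eq.trans (hY_law 0).map_eq.symm⟩
    exact (h1.prodMk h2 (hpair n) (hpair 0)).comp (u := fun (z : ℝ × ℝ) (b : Bool) => cond b z.1 z.2)
      (measurable_pi_lambda _ (by
        rintro (_ | _)
        exacts [measurable_snd, measurable_fst]))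
  have hf : Measurable f := by fun_prop
  have hloc : DependsOn f (Set.Iio m) := fun w w' hw => by
    have h1 : w δ = w' δ := hw δ (by simp only [Set.mem_Iio]; omega)
    have h2 : ∀ k ∈ Finset.range m, markInd (w k false) = markInd (w' k false) := fun k hk => by
      rw [hw k (by simpa using hk)]
    simp only [f, h1, Finset.sum_congr rfl h2]
  have hC : ∀ w, |f w| ≤ m + |m * p * q| := fun w => by
    refine (abs_sub _ _).trans (add_le_add_left ?_ _)
    rw [abs_mul]
    have h1 : |∑ k ∈ Finset.range m, markInd (w k false)| ≤ m := by
      refine (Finset.abs_sum_le_sum_abs _ _).trans ?_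
      simpa using Finset.sum_le_card_nsmul (Finset.range m) _ 1
        fun k _ => abs_markInd_le_one (w k false)
    exact (mul_le_mul (abs_markInd_le_one _) h1 (abs_nonneg _) zero_le_one).trans_eq (one_mul _)
  have mξ : ∀ n, Measurable (ξ n) := fun n => by fun_prop
  have iξ : ∀ n, Integrable (ξ n) P := fun n =>
    .of_bound (mξ n).aestronglyMeasurable _ (ae_of_all _ fun ω => hC fun k => W (n + k) ω)
  have iξξ : ∀ i j, Integrable (fun ω => ξ i ω * ξ j ω) P := fun i j =>
    (iξ j).bdd_mul (mξ i).aestronglyMeasurable (ae_of_all _ fun ω => hC fun k => W (i + k) ω)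
  have meanξ : ∀ n, ∫ ω, ξ n ω ∂P = 0 := fun n => by
    have h1 := integral_mul_sum_range mU mV bV hUV eU eV m (n + δ) n
    have h2 : ∫ ω, (ξ n ω + m * p * q) ∂P = m * p * q := by
      simpa only [ξ, sub_add_cancel] using h1
    rw [integral_add (iξ n) (integrable_const _)] at h2
    simpa using h2
  have cov : ∀ i d, ∫ ω, ξ i ω * ξ (i + d) ω ∂P =
      (if d = 0 then p else p ^ 2) * (m ^ 2 * q ^ 2 + (q - q ^ 2) * (m - d : ℕ))
        - m ^ 2 * p ^ 2 * q ^ 2 := fun i d => by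
    have := integral_rowSum_mul_rowSum mU mV bU bV hUV eU eV eVV m δ i d
    rw [eUU] at this
    simp only [left_eq_add, add_right_comm i d δ] at this
    rw [← this]
    simp only [ξ, add_right_comm i d δ]
  have hlim : Tendsto (fun L : ℕ => (∫ ω, (∑ i ∈ Finset.range L, f (fun k => W (i + k) ω)) ^ 2 ∂P)
      / L) atTop (nhds (sigmaSq pX pY δ).toNNReal) := by
    rw [Real.coe_toNNReal _ (sigmaSq_nonneg pX pY δ)]
    -- From `L = m` on, every lag with nonzero covariance lies inside the range, so the increment
    -- equals `σ_δ²`.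
    refine tendsto_integral_sq_sum_range_div (ξ := ξ) iξξ (M := m) fun L hL => ?_
    have h1 : ∀ i ∈ Finset.range L, ∫ ω, ξ i ω * ξ L ω ∂P =
        p ^ 2 * (q - q ^ 2) * (m - (L - i) : ℕ) := fun i hi => by
      have hi' := Finset.mem_range.1 hi
      have := cov i (L - i)
      rw [Nat.add_sub_cancel' hi'.le, if_neg (by omega)] at this
      rw [this]; ring
    have h2 := cov L 0
    rw [add_zero, if_pos rfl, Nat.sub_zero] at h2
    rw [h2, Finset.sum_congr rfl h1, ← Finset.mul_sum, mul_left_comm, two_mul_sum_range_tsub hL,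
      sigmaSq, hm]
    push_cast
    ring
  have hclt := tendstoInDistribution_sum_window hW mW hid hf hloc hC
    ((integral_congr_ae (ae_of_all _ fun ω => by simp only [← hξ, zero_add])).trans (meanξ 0)) hlim
  simp only [hξ] at hclt
  have hnum : ∀ T ω, |numMarks X Y δ T ω - T * (m * p * q) - ∑ n ∈ Finset.range T, ξ n ω| ≤
      ((2 * δ + 1) * (3 * δ + 1) : ℕ) := fun T ω => by
    have := abs_card_bandMarks_sub_le (fun i => X i ω) (fun j => Y j ω) T δ
    convert this using 2
    simp only [numMarks, ξ, Finset.sum_sub_distrib, Finset.sum_const, Finset.card_range,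
      nsmul_eq_mul, U, V]
    ring
  have mnum : ∀ T, Measurable (numMarks X Y δ T) := fun T => by
    have : numMarks X Y δ T = fun ω => ∑ q ∈ band T δ, markInd (X q.1 ω) * markInd (Y q.2 ω) := by
      ext ω
      exact card_bandMarks _ _ T δ
    rw [this]
    refine Finset.measurable_sum _ fun q hq => ?_
    simp only [band, Finset.mem_filter, Finset.mem_product, Finset.mem_Icc] at hq
    have h1 := mX (q.1 - 1)
    have h2 := mY (q.2 - 1)
    rw [Nat.sub_add_cancel (by omega)] at h1 h2
    exact (measurable_markInd.comp h1).mul (measurable_markInd.comp h2)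
  set K : ℝ := (((2 * δ + 1) * (3 * δ + 1) : ℕ) : ℝ)
  have isum : ∀ T : ℕ, Integrable (fun ω => ∑ n ∈ Finset.range T, ξ n ω) P := fun T =>
    integrable_finsetSum _ fun n _ => iξ n
  have irem : ∀ T : ℕ, Integrable (fun ω => numMarks X Y δ T ω - T * (m * p * q) -
      ∑ n ∈ Finset.range T, ξ n ω) P := fun T =>
    .of_bound (((mnum T).sub_const _).sub (by fun_prop)).aestronglyMeasurable K
      (ae_of_all _ (hnum T))
  have inum : ∀ T, Integrable (numMarks X Y δ T) P := fun T => by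
    have := ((irem T).add (isum T)).add (integrable_const (T * (m * p * q)))
    refine this.congr (ae_of_all _ fun ω => ?_)
    simp only [Pi.add_apply]
    ring
  -- The pointwise boundary error also bounds the error in the mean; together they give `2K / √T`.
  have hmean : ∀ T : ℕ, |∫ ω, numMarks X Y δ T ω ∂P - T * (m * p * q)| ≤ K := fun T => by
    have h1 : ∫ ω, (numMarks X Y δ T ω - T * (m * p * q) - ∑ n ∈ Finset.range T, ξ n ω) ∂P =
        ∫ ω, numMarks X Y δ T ω ∂P - T * (m * p * q) := by
      have i1 : Integrable (fun ω => numMarks X Y δ T ω - T * (m * p * q)) P :=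
        (inum T).sub (integrable_const _)
      rw [integral_sub i1 (isum T),
        integral_sub (inum T) (integrable_const _), integral_finsetSum _ fun n _ => iξ n]
      simp [meanξ]
    rw [← h1]
    simpa using norm_integral_le_of_norm_le_const (μ := P)
      (ae_of_all _ fun ω => (Real.norm_eq_abs _).trans_le (hnum T ω))
  refine tendstoInDistribution_of_tendstoInMeasure_sub _ _ hclt ?_
    (fun T => (((mnum T).sub_const _).div_const _).aemeasurable)
  refine tendstoInMeasure_of_tendsto_ae (fun T => Measurable.aestronglyMeasurable
    ((((mnum T).sub_const _).div_const _).sub (by fun_prop))) (ae_of_all _ fun ω => ?_)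
  have h0 : Tendsto (fun T : ℕ => 2 * K / √(T : ℝ)) atTop (nhds 0) :=
    tendsto_const_nhds.div_atTop (Real.tendsto_sqrt_atTop.comp tendsto_natCast_atTop_atTop)
  refine squeeze_zero_norm (fun T => ?_) h0
  have h1 : (numMarks X Y δ T ω - ∫ ω', numMarks X Y δ T ω' ∂P) / √(T : ℝ) -
      (√(T : ℝ))⁻¹ * ∑ n ∈ Finset.range T, ξ n ω =
      ((numMarks X Y δ T ω - T * (m * p * q) - ∑ n ∈ Finset.range T, ξ n ω) -
        (∫ ω, numMarks X Y δ T ω ∂P - T * (m * p * q))) / √(T : ℝ) := by ring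
  simp only [Pi.sub_apply]
  rw [h1, Real.norm_eq_abs, abs_div, abs_of_nonneg (Real.sqrt_nonneg _)]
  refine div_le_div_of_nonneg_right ?_ (Real.sqrt_nonneg _)
  exact (abs_sub _ _).trans ((add_le_add (hnum T ω) (hmean T)).trans_eq (two_mul K).symm)

theorem mainTheorem1 {Ω : Type*} [MeasurableSpace Ω] (P : Measure Ω) [IsProbabilityMeasure P]
    (pX pY : I) (X Y : ℕ → Ω → ℝ) (δ : ℕ)
    (hX_law : ∀ n : ℕ, HasLaw (X (n + 1)) (bernoulliMeasure (1 : ℝ) 0 pX) P)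
    (hY_law : ∀ n : ℕ, HasLaw (Y (n + 1)) (bernoulliMeasure (1 : ℝ) 0 pY) P)
    (hX_indep : iIndepFun (fun n : ℕ => X (n + 1)) P)
    (hY_indep : iIndepFun (fun n : ℕ => Y (n + 1)) P)
    (hXY_indep : IndepFun (fun ω (n : ℕ) => X (n + 1) ω) (fun ω (n : ℕ) => Y (n + 1) ω) P) :
    TendstoInDistribution
      (fun (T : ℕ) (ω : Ω) =>
        (numMarks X Y δ T ω - ∫ ω', numMarks X Y δ T ω' ∂P) / Real.sqrt (T : ℝ))
      atTop
      (fun z : ℝ => z)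
      (fun _ => P)
      (gaussianReal 0 (sigmaSq pX pY δ).toNNReal) := by
  -- Measurable modifications; `n - 1` matches the indexing from `1`, and the junk value at `n = 0`
  -- never enters the count.
  let X' : ℕ → Ω → ℝ := fun n => (hX_law (n - 1)).aemeasurable.mk
  let Y' : ℕ → Ω → ℝ := fun n => (hY_law (n - 1)).aemeasurable.mk
  have eX : ∀ n, X (n + 1) =ᵐ[P] X' (n + 1) := fun n => (hX_law n).aemeasurable.ae_eq_mk
  have eY : ∀ n, Y (n + 1) =ᵐ[P] Y' (n + 1) := fun n => (hY_law n).aemeasurable.ae_eq_mk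
  have hnum : ∀ T, numMarks X' Y' δ T =ᵐ[P] numMarks X Y δ T := fun T => by
    filter_upwards [ae_all_iff.2 eX, ae_all_iff.2 eY] with ω hx hy
    simp only [numMarks, card_bandMarks]
    refine Finset.sum_congr rfl fun q hq => ?_
    simp only [band, Finset.mem_filter, Finset.mem_product, Finset.mem_Icc] at hq
    have h1 := hx (q.1 - 1)
    have h2 := hy (q.2 - 1)
    rw [Nat.sub_add_cancel (by omega)] at h1 h2
    rw [h1, h2]
  have main := tendstoInDistribution_numMarks P pX pY X' Y' δ
    (fun n => (hX_law n).aemeasurable.measurable_mk)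
    (fun n => (hY_law n).aemeasurable.measurable_mk)
    (fun n => (hX_law n).congr (eX n).symm) (fun n => (hY_law n).congr (eY n).symm)
    ((iIndepFun_congr eX).1 hX_indep) ((iIndepFun_congr eY).1 hY_indep)
    (hXY_indep.process_congr eX eY)
  refine main.congr (fun T => ?_) .rfl
  filter_upwards [hnum T] with ω h
  rw [h, integral_congr_ae (hnum T)]
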